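/- **Theorem (Quadratic Convergence in the Non-smooth Case).** Let $H$ be a complex Hilbert space (e.g. $\ell^2(\mathbb N)$ or $\mathbb C^n$), let $A_1,\dots,A_\kappa$ be compact self-adjoint operators on $H$, let $\Omega=[a,b]$ be a compact interval, let $f_1,\dots,f_\kappa:\underline\Omega\to\mathbb R$ be real analytic on an open interval $\underline\Omega\supseteq\Omega$, and put $\mathcal A(\omega)=\sum_{i=1}^{\kappa} f_i(\omega)A_i$. Let $\lambda_j(T)$ denote the $j$-th largest eigenvalue of $T$, counted with multiplicity, and $\lambda_{\max}=\lambda_1$. For a finite-dimensional subspace $\mathcal V\subseteq H$ let $\mathcal A^{\mathcal V}(\omega)=V^*\mathcal A(\omega)V$, where $V:\mathcal V\to H$ is the inclusion. Given $\varepsilon>0$, let $S_\varepsilon(\omega)$ be the span of the eigenvectors of $\mathcal A(\omega)$ belonging to all eigenvalues $\mu$ with $\lambda_{\max}(\mathcal A(\omega))-\mu\le\varepsilon$. The generalized subspace procedure starts from an arbitrary $\omega^{(1)}\in\Omega$ and $\mathcal V_1=S_\varepsilon(\omega^{(1)})$, and for $k=1,2,\dots$ takes for $\omega^{(k+1)}$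 a global minimizer of $\omega\mapsto\lambda_{\max}(\mathcal A^{\mathcal V_k}(\omega))$ over $\Omega$ and sets $\mathcal V_{k+1}=\mathcal V_k+S_\varepsilon(\omega^{(k+1)})$; all the subspaces $\mathcal V_k$ are supposed to be finite-dimensional. Suppose that $\omega\mapsto\lambda_{\max}(\mathcal A(\omega))$ has a unique global minimizer $\omega_*$ over $\Omega$, that $\lambda_{\max}(\mathcal A(\omega_*))$ is an eigenvalue of finite multiplicity $K\ge 2$, and that $$0\notin \mathrm{bd}\,\partial\lambda_j(\mathcal A(\omega_*)),\qquad j=1,\dots,K,$$ where, for a function $g$ that is differentiable almost everywhere, $\partial g(\omega_*)$ is the generalized (Clarke) derivative, i.e. the convex hull of all limits $\lim_n g'(u_n)$ along sequences $u_n\to\omega_*$ of points of differentiability of $g$. (This condition says that $\lambda_1(\mathcal A(\omega)),\dots,\lambda_K(\mathcal A(\omega))$ have nonzero one-sided derivatives at $\omega_*$.) Then every sequence $\{\omega^{(k)}\}$ generated by the procedure satisfies $$|\omega^{(k+1)}-\omega_*| = O\big((\omega^{(k)}-\omega_*)^2\big)\qquad\text{for all large }k,$$ i.e. there is a constant $C$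 with $|\omega^{(k+1)}-\omega_*|\le C(\omega^{(k)}-\omega_*)^2$ for all sufficiently large $k$. -/

import Mathlib

open Set Filter Topology Asymptotics

namespace SubspaceFramework

noncomputable section

variable {E : Type*} [NormedAddCommGroup E] [InnerProductSpace ℂ E]

/-- The largest (real) eigenvalue of `T`. -/
def lambdaMax (T : E →L[ℂ] E) : ℝ :=
  sSup {t : ℝ | Module.End.HasEigenvalue (T : E →ₗ[ℂ] E) (t : ℂ)}

/-- The `j`-th largest eigenvalue of `T` (for `1 ≤ j`), counted with multiplicity: the largest
eigenvalue `t` such that the eigenspaces of the eigenvalues `≥ t` have total dimension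
at least `j`. -/
def nthEigenvalue (T : E →L[ℂ] E) (j : ℕ) : ℝ :=
  sSup {t : ℝ | Module.End.HasEigenvalue (T : E →ₗ[ℂ] E) (t : ℂ) ∧
    (j : Cardinal) ≤ Module.rank ℂ
      ↥(⨆ (s : ℝ) (_ : t ≤ s), Module.End.eigenspace (T : E →ₗ[ℂ] E) (s : ℂ))}

/-- Consistency of the two definitions. -/
theorem nthEigenvalue_one (T : E →L[ℂ] E) : nthEigenvalue T 1 = lambdaMax T := by
  unfold nthEigenvalue lambdaMax
  congr 1
  ext t
  simp only [mem_ofPred_eq, and_iff_left_iff_imp]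
  intro h
  obtain ⟨v, hv, hv0⟩ := h.exists_hasEigenvector
  have hmem : v ∈ ⨆ (s : ℝ) (_ : t ≤ s),
      Module.End.eigenspace (T : E →ₗ[ℂ] E) (s : ℂ) :=
    (le_iSup₂_of_le (f := fun (s : ℝ) (_ : t ≤ s) =>
      Module.End.eigenspace (T : E →ₗ[ℂ] E) (s : ℂ)) t le_rfl le_rfl) hv
  rw [Nat.cast_one, Cardinal.one_le_iff_pos, rank_pos_iff_exists_ne_zero]
  exact ⟨⟨v, hmem⟩, fun h0 => hv0 (by simpa using congrArg Subtype.val h0)⟩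

/-- The span of the eigenvectors belonging to the eigenvalues of `T` that are at most `ε` away
from the largest one. -/
def nearTopEigenspace (T : E →L[ℂ] E) (ε : ℝ) : Submodule ℂ E :=
  ⨆ (t : ℝ) (_ : lambdaMax T - t ≤ ε), Module.End.eigenspace (T : E →ₗ[ℂ] E) (t : ℂ)

/-- The projected operator `V* T V` on a subspace, `V` being the isometric inclusion and `V*` its
adjoint, the orthogonal projection. In an orthonormal basis of the subspace this is the usual
projected matrix. -/
def compression (T : E →L[ℂ] E) (V : Submodule ℂ E) [V.HasOrthogonalProjection] : V →L[ℂ] V :=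
  V.orthogonalProjectionOnto ∘L T ∘L V.subtypeL

/-- The operator-valued function `ω ↦ ∑ i, f i ω • A i`. -/
def operatorFamily {κ : ℕ} (f : Fin κ → ℝ → ℝ) (A : Fin κ → E →L[ℂ] E) (ω : ℝ) : E →L[ℂ] E :=
  ∑ i, ((f i ω : ℝ) : ℂ) • A i

/-- `ω` and `V` are the iterates and the subspaces of a run of the generalized subspace procedure
for `A` on `Ω` with tolerance `ε` (numbered from `0`). Only finitely many eigenvectors are added
at each step, so the subspaces are finite dimensional. -/
structure IsSubspaceProcedure (A : ℝ → E →L[ℂ] E) (Ω : Set ℝ) (ε : ℝ)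
    (ω : ℕ → ℝ) (V : ℕ → Submodule ℂ E) : Prop where
  finiteDimensional : ∀ k, FiniteDimensional ℂ (V k)
  init_mem : ω 0 ∈ Ω
  init_subspace : V 0 = nearTopEigenspace (A (ω 0)) ε
  step_mem : ∀ k, ω (k + 1) ∈ Ω
  step_isMinOn : ∀ k, haveI := finiteDimensional k
    IsMinOn (fun x : ℝ => lambdaMax (compression (A x) (V k))) Ω (ω (k + 1))
  step_subspace : ∀ k, V (k + 1) = V k ⊔ nearTopEigenspace (A (ω (k + 1))) ε

/-- The generalized (Clarke) derivative at `x` of a univariate function that is differentiable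
almost everywhere: the convex hull of all limits of `g' (u n)`, where `u n → x` runs through
points of differentiability of `g`. -/
def clarkeDeriv (g : ℝ → ℝ) (x : ℝ) : Set ℝ :=
  convexHull ℝ {d : ℝ | ∃ u : ℕ → ℝ, Tendsto u atTop (𝓝 x) ∧
    (∀ n, DifferentiableAt ℝ g (u n)) ∧ Tendsto (fun n => deriv g (u n)) atTop (𝓝 d)}

end

end SubspaceFramework

/-! Write `λ` for the largest eigenvalue at the minimizer `x₀` and `B` for the derivative of the
family there. Minimality of the step and monotonicity of compressions give `⟨A(ω (k+1)) v, v⟩ ≤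
λ‖v‖²` for every `v` in `V k` (`reApplyInnerSelf_step_le`). Project a top eigenvector `e` at `x₀`
onto the near-top eigenspace at `ω k`, which lies in `V k`. The margin `ε` gives `‖v - e‖ = O(|ω k -
x₀|)` (`norm_sub_starProjection_le`). Since `e` is a critical point of the Rayleigh quotient, `λ‖v‖²
- ⟨A(x₀) v, v⟩` is only `O(‖v - e‖²)` (`reApplyInnerSelf_add_of_mem_eigenspace`). With `δ = ω (k+1)
- x₀`, linearizing at `x₀` bounds `δ⟨Be, e⟩`, up to a small multiple of `|δ|`, by `O((ω k - x₀)²)`.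
This is the desired bound whenever `δ⟨Be, e⟩ > 0` (`exists_abs_sub_le`).

So a top eigenvector of positive slope is needed for iterates to the right of `x₀`, and one of
negative slope for those to the left. If `B ≤ 0` on the top eigenspace, the largest eigenvalue has
difference quotients at most `θ` near `x₀`, for each `θ > 0`. Minimality also yields derivatives at
least `-θ` at nearby points, so zero is the right end of the Clarke derivative, contrary to
assumption (`zero_mem_frontier_clarkeDeriv`). The left side follows by reflection.

Convergence of the iterates comes from interpolation: `V m` reproduces the largest eigenvalue at all
earlier iterates (`lambdaMax_iterate_le`). -/

namespace SubspaceFramework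

/-! ### Quadratic forms and largest eigenvalues of compact symmetric operators -/

section Spectral

variable {E : Type*} [NormedAddCommGroup E] [InnerProductSpace ℂ E]

/-- The span of the eigenvectors belonging to the real eigenvalues in `J`. -/
def eigenspaceSum (T : E →L[ℂ] E) (J : Set ℝ) : Submodule ℂ E :=
  ⨆ (t : ℝ) (_ : t ∈ J), Module.End.eigenspace (T : E →ₗ[ℂ] E) (t : ℂ)

theorem eigenspace_le_eigenspaceSum (T : E →L[ℂ] E) {J : Set ℝ} {t : ℝ} (ht : t ∈ J) :
    Module.End.eigenspace (T : E →ₗ[ℂ] E) (t : ℂ) ≤ eigenspaceSum T J :=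
  le_iSup₂_of_le (f := fun (s : ℝ) (_ : s ∈ J) =>
    Module.End.eigenspace (T : E →ₗ[ℂ] E) (s : ℂ)) t ht le_rfl

theorem apply_mem_eigenspaceSum {T : E →L[ℂ] E} {J : Set ℝ} {v : E}
    (hv : v ∈ eigenspaceSum T J) : T v ∈ eigenspaceSum T J := by
  have : eigenspaceSum T J ≤ (eigenspaceSum T J).comap (T : E →ₗ[ℂ] E) := by
    refine iSup₂_le fun t ht x hx => ?_
    have hx' : T x = (t : ℂ) • x := Module.End.mem_eigenspace_iff.1 hx
    simp only [Submodule.mem_comap, ContinuousLinearMap.coe_coe, hx']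
    exact Submodule.smul_mem _ _ (eigenspace_le_eigenspaceSum T ht hx)
  exact this hv

theorem inner_ofReal_smul_self (c : ℝ) (v : E) :
    inner ℂ ((c : ℂ) • v) v = ((c * ‖v‖ ^ 2 : ℝ) : ℂ) := by
  rw [inner_smul_left, inner_self_eq_norm_sq_to_K, Complex.conj_ofReal]
  simp

theorem reApplyInnerSelf_eq_of_mem_eigenspace {T : E →L[ℂ] E} {t : ℝ} {v : E}
    (hv : v ∈ Module.End.eigenspace (T : E →ₗ[ℂ] E) (t : ℂ)) :
    T.reApplyInnerSelf v = t * ‖v‖ ^ 2 := by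
  have hv' : T v = (t : ℂ) • v := Module.End.mem_eigenspace_iff.1 hv
  rw [ContinuousLinearMap.reApplyInnerSelf_apply, hv', inner_ofReal_smul_self]
  exact Complex.ofReal_re _

theorem eigenspace_isOrtho {T : E →L[ℂ] E} (hs : (T : E →ₗ[ℂ] E).IsSymmetric) {s t : ℝ}
    (hst : s ≠ t) {v w : E} (hv : v ∈ Module.End.eigenspace (T : E →ₗ[ℂ] E) (s : ℂ))
    (hw : w ∈ Module.End.eigenspace (T : E →ₗ[ℂ] E) (t : ℂ)) : inner ℂ v w = 0 :=
  hs.orthogonalFamily_eigenspaces (i := (s : ℂ)) (j := (t : ℂ))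
    (by simpa using hst) ⟨v, hv⟩ ⟨w, hw⟩

/-- Orthogonality of the eigenspaces removes the cross terms, so the Rayleigh quotient is a weighted
mean of eigenvalues in `J`. -/
theorem exists_sum_of_mem_eigenspaceSum {T : E →L[ℂ] E} (hs : (T : E →ₗ[ℂ] E).IsSymmetric)
    {J : Set ℝ} {v : E} (hv : v ∈ eigenspaceSum T J) :
    ∃ (s : Finset J) (g : J → ℝ), (∀ t, 0 ≤ g t) ∧ ‖v‖ ^ 2 = ∑ t ∈ s, g t ∧
      T.reApplyInnerSelf v = ∑ t ∈ s, (t : ℝ) * g t := by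
  classical
  rw [eigenspaceSum, ← iSup_subtype'', Submodule.mem_iSup_iff_exists_finsupp] at hv
  obtain ⟨f, hf, rfl⟩ := hv
  have hTf (t : J) : T (f t) = ((t : ℝ) : ℂ) • f t := Module.End.mem_eigenspace_iff.1 (hf t)
  have hsum (c : J → ℝ) : inner ℂ (∑ t ∈ f.support, ((c t : ℝ) : ℂ) • f t)
      (∑ t ∈ f.support, f t) = ((∑ t ∈ f.support, c t * ‖f t‖ ^ 2 : ℝ) : ℂ) := by
    rw [sum_inner, Complex.ofReal_sum]
    refine Finset.sum_congr rfl fun t ht => ?_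
    rw [inner_sum, Finset.sum_eq_single t]
    · exact inner_ofReal_smul_self _ _
    · intro s _ hst
      rw [inner_smul_left, eigenspace_isOrtho hs (fun h => hst (Subtype.ext h.symm)) (hf t) (hf s),
        mul_zero]
    · exact fun h => absurd ht h
  refine ⟨f.support, fun t => ‖f t‖ ^ 2, fun t => by positivity, ?_, ?_⟩
  · have h := hsum fun _ => 1
    simp only [Complex.ofReal_one, one_smul, one_mul] at h
    rw [← inner_self_eq_norm_sq (𝕜 := ℂ)]
    exact (congrArg Complex.re h).trans (Complex.ofReal_re _)
  · have h := hsum fun t => t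
    rw [ContinuousLinearMap.reApplyInnerSelf_apply, Finsupp.sum, map_sum]
    simp only [hTf]
    exact (congrArg Complex.re h).trans (Complex.ofReal_re _)

theorem reApplyInnerSelf_le_of_mem_eigenspaceSum {T : E →L[ℂ] E}
    (hs : (T : E →ₗ[ℂ] E).IsSymmetric) {J : Set ℝ} {c : ℝ} (hJ : ∀ t ∈ J, t ≤ c) {v : E}
    (hv : v ∈ eigenspaceSum T J) : T.reApplyInnerSelf v ≤ c * ‖v‖ ^ 2 := by
  obtain ⟨s, g, hg, h1, h2⟩ := exists_sum_of_mem_eigenspaceSum hs hv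
  rw [h1, h2, Finset.mul_sum]
  exact Finset.sum_le_sum fun t _ => mul_le_mul_of_nonneg_right (hJ t t.2) (hg t)

theorem le_reApplyInnerSelf_of_mem_eigenspaceSum {T : E →L[ℂ] E}
    (hs : (T : E →ₗ[ℂ] E).IsSymmetric) {J : Set ℝ} {c : ℝ} (hJ : ∀ t ∈ J, c ≤ t) {v : E}
    (hv : v ∈ eigenspaceSum T J) : c * ‖v‖ ^ 2 ≤ T.reApplyInnerSelf v := by
  obtain ⟨s, g, hg, h1, h2⟩ := exists_sum_of_mem_eigenspaceSum hs hv
  rw [h1, h2, Finset.mul_sum]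
  exact Finset.sum_le_sum fun t _ => mul_le_mul_of_nonneg_right (hJ t t.2) (hg t)

theorem bddAbove_eigenvalues (T : E →L[ℂ] E) :
    BddAbove {t : ℝ | Module.End.HasEigenvalue (T : E →ₗ[ℂ] E) (t : ℂ)} := by
  refine ⟨‖T‖, fun t ht => ?_⟩
  obtain ⟨v, hv, hv0⟩ := ht.exists_hasEigenvector
  have hv' : T v = (t : ℂ) • v := Module.End.mem_eigenspace_iff.1 hv
  have h := T.le_opNorm v
  rw [hv', norm_smul, Complex.norm_real] at h
  exact (le_abs_self t).trans (le_of_mul_le_mul_right h (norm_pos_iff.2 hv0))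

theorem abs_reApplyInnerSelf_le (T : E →L[ℂ] E) (v : E) :
    |T.reApplyInnerSelf v| ≤ ‖T‖ * ‖v‖ ^ 2 := by
  rw [ContinuousLinearMap.reApplyInnerSelf_apply]
  refine (RCLike.abs_re_le_norm _).trans ((norm_inner_le_norm _ _).trans ?_)
  calc ‖T v‖ * ‖v‖ ≤ ‖T‖ * ‖v‖ * ‖v‖ := by gcongr; exact T.le_opNorm v
    _ = ‖T‖ * ‖v‖ ^ 2 := by ring

theorem reApplyInnerSelf_sub (T S : E →L[ℂ] E) (v : E) :
    (T - S).reApplyInnerSelf v = T.reApplyInnerSelf v - S.reApplyInnerSelf v := by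
  simp [ContinuousLinearMap.reApplyInnerSelf_apply, inner_sub_left]

variable [CompleteSpace E]

/-- Eigenvalues are real, so `J` and `Jᶜ` together account for all of them, and the spectral theorem
says that their eigenspaces span a dense subspace. -/
theorem orthogonal_eigenspaceSum_inf_orthogonal_compl {T : E →L[ℂ] E}
    (hs : (T : E →ₗ[ℂ] E).IsSymmetric) (hc : IsCompactOperator T) (J : Set ℝ) {v : E}
    (h1 : v ∈ (eigenspaceSum T J)ᗮ) (h2 : v ∈ (eigenspaceSum T Jᶜ)ᗮ) : v = 0 := by
  have h : v ∈ (⨆ μ, Module.End.eigenspace (T : Module.End ℂ E) μ)ᗮ := by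
    rw [← Submodule.iInf_orthogonal, Submodule.mem_iInf]
    intro μ
    by_cases hμ : Module.End.HasEigenvalue (T : Module.End ℂ E) μ
    · obtain ⟨t, rfl⟩ := Complex.conj_eq_iff_real.1 (hs.conj_eigenvalue_eq_self hμ)
      by_cases ht : t ∈ J
      · exact Submodule.orthogonal_le (eigenspace_le_eigenspaceSum T ht) h1
      · exact Submodule.orthogonal_le (eigenspace_le_eigenspaceSum T (J := Jᶜ) ht) h2
    · rw [Module.End.hasEigenvalue_iff, not_not] at hμ
      rw [hμ, Submodule.bot_orthogonal_eq_top]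
      trivial
  rwa [ContinuousLinearMap.orthogonalComplement_iSup_eigenspaces_eq_bot hc hs,
    Submodule.mem_bot] at h

/-- A compact self-adjoint operator is bounded above by `c` on the orthogonal complement of the
eigenvectors whose eigenvalues exceed `c`. -/
theorem reApplyInnerSelf_le_of_mem_orthogonal {T : E →L[ℂ] E}
    (hs : (T : E →ₗ[ℂ] E).IsSymmetric) (hc : IsCompactOperator T) {J : Set ℝ} {c : ℝ}
    (hJ : ∀ t : ℝ, Module.End.HasEigenvalue (T : E →ₗ[ℂ] E) (t : ℂ) → c < t → t ∈ J) {v : E}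
    (hv : v ∈ (eigenspaceSum T J)ᗮ) : T.reApplyInnerSelf v ≤ c * ‖v‖ ^ 2 := by
  -- The part of `v` outside `M` is orthogonal to all eigenvectors, so `v ∈ M`. The bound holds on
  -- the span of the remaining eigenvectors and passes to its closure.
  set M : Submodule ℂ E := (eigenspaceSum T Jᶜ).topologicalClosure with hM
  have : CompleteSpace M := (eigenspaceSum T Jᶜ).isClosed_topologicalClosure.completeSpace_coe
  have hMJ : M ≤ (eigenspaceSum T J)ᗮ := by
    refine Submodule.topologicalClosure_minimal _ ?_ (Submodule.isClosed_orthogonal _)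
    refine iSup₂_le fun t ht x hx => ?_
    have : eigenspaceSum T J ≤ (Submodule.span ℂ {x})ᗮ := by
      refine iSup₂_le fun s hs' y hy => ?_
      rw [Submodule.mem_orthogonal_singleton_iff_inner_right]
      exact eigenspace_isOrtho hs (fun h => ht (Set.mem_of_eq_of_mem h hs')) hx hy
    rw [Submodule.mem_orthogonal']
    intro y hy
    exact (Submodule.mem_orthogonal_singleton_iff_inner_right).1 (this hy)
  have hvM : v ∈ M := by
    have h0 : v - M.starProjection v = 0 := by
      refine orthogonal_eigenspaceSum_inf_orthogonal_compl hs hc J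
        (Submodule.sub_mem _ hv (hMJ (Submodule.starProjection_apply_mem _ _))) ?_
      exact Submodule.orthogonal_le (Submodule.le_topologicalClosure _)
        (Submodule.sub_starProjection_mem_orthogonal v)
    rw [sub_eq_zero.1 h0]
    exact Submodule.starProjection_apply_mem _ _
  have hle : ∀ x ∈ eigenspaceSum T Jᶜ, T.reApplyInnerSelf x ≤ c * ‖x‖ ^ 2 := by
    have : eigenspaceSum T Jᶜ ≤ eigenspaceSum T {t | t ≤ c} := by
      refine iSup₂_le fun t ht => ?_
      by_cases hev : Module.End.HasEigenvalue (T : E →ₗ[ℂ] E) (t : ℂ)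
      · exact eigenspace_le_eigenspaceSum T (not_lt.1 fun h => ht (hJ t hev h))
      · rw [Module.End.hasEigenvalue_iff, not_not] at hev
        rw [hev]
        exact bot_le
    exact fun x hx => reApplyInnerSelf_le_of_mem_eigenspaceSum hs (fun t ht => ht) (this hx)
  have hcl : IsClosed {x : E | T.reApplyInnerSelf x ≤ c * ‖x‖ ^ 2} :=
    isClosed_le T.reApplyInnerSelf_continuous (by fun_prop)
  exact closure_minimal hle hcl hvM

theorem reApplyInnerSelf_le_lambdaMax {T : E →L[ℂ] E} (hs : (T : E →ₗ[ℂ] E).IsSymmetric)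
    (hc : IsCompactOperator T) (v : E) : T.reApplyInnerSelf v ≤ lambdaMax T * ‖v‖ ^ 2 := by
  refine reApplyInnerSelf_le_of_mem_orthogonal hs hc (J := ∅)
    (fun t ht h => absurd (le_csSup (bddAbove_eigenvalues T) ht) (not_le.2 h)) ?_
  simp [eigenspaceSum]

variable [Nontrivial E]

theorem exists_hasEigenvalue {T : E →L[ℂ] E} (hs : (T : E →ₗ[ℂ] E).IsSymmetric)
    (hc : IsCompactOperator T) : ∃ t : ℝ, Module.End.HasEigenvalue (T : E →ₗ[ℂ] E) (t : ℂ) := by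
  by_contra! h
  have hbot (J : Set ℝ) : eigenspaceSum T J = ⊥ := by
    refine eq_bot_iff.2 (iSup₂_le fun t _ => ?_)
    have := h t
    rw [Module.End.hasEigenvalue_iff, not_not] at this
    rw [this]
  obtain ⟨v, hv⟩ := exists_ne (0 : E)
  exact hv (orthogonal_eigenspaceSum_inf_orthogonal_compl hs hc ∅ (by simp [hbot]) (by simp [hbot]))

/-- The slack `η` is needed because the supremum need not be attained: for a negative injective
compact operator in infinite dimension it is `0`. -/
theorem exists_unit_eigenvector {T : E →L[ℂ] E} (hs : (T : E →ₗ[ℂ] E).IsSymmetric)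
    (hc : IsCompactOperator T) {η : ℝ} (hη : 0 < η) :
    ∃ t : ℝ, lambdaMax T - η < t ∧ ∃ v : E,
      v ∈ Module.End.eigenspace (T : E →ₗ[ℂ] E) (t : ℂ) ∧ ‖v‖ = 1 := by
  obtain ⟨t, ht, hlt⟩ := exists_lt_of_lt_csSup (exists_hasEigenvalue hs hc)
    (show lambdaMax T - η < lambdaMax T by linarith)
  obtain ⟨v, hv, hv0⟩ := Module.End.HasEigenvalue.exists_hasEigenvector ht
  refine ⟨t, hlt, ((‖v‖⁻¹ : ℝ) : ℂ) • v, Submodule.smul_mem _ _ hv, ?_⟩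
  rw [norm_smul, Complex.norm_real, norm_inv, norm_norm, inv_mul_cancel₀ (norm_ne_zero_iff.2 hv0)]

theorem lambdaMax_le {T : E →L[ℂ] E} (hs : (T : E →ₗ[ℂ] E).IsSymmetric)
    (hc : IsCompactOperator T) {c : ℝ} (h : ∀ v, T.reApplyInnerSelf v ≤ c * ‖v‖ ^ 2) :
    lambdaMax T ≤ c := by
  refine le_of_forall_pos_lt_add fun η hη => ?_
  obtain ⟨t, hlt, v, hv, hv1⟩ := exists_unit_eigenvector hs hc hη
  have := h v
  rw [reApplyInnerSelf_eq_of_mem_eigenspace hv, hv1] at this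
  linarith

theorem lambdaMax_le_add_norm_sub {T S : E →L[ℂ] E} (hT : (T : E →ₗ[ℂ] E).IsSymmetric)
    (hTc : IsCompactOperator T) (hS : (S : E →ₗ[ℂ] E).IsSymmetric)
    (hSc : IsCompactOperator S) : lambdaMax T ≤ lambdaMax S + ‖T - S‖ := by
  refine lambdaMax_le hT hTc fun v => ?_
  have h1 := reApplyInnerSelf_le_lambdaMax hS hSc v
  have h2 := (le_abs_self _).trans (abs_reApplyInnerSelf_le (T - S) v)
  rw [reApplyInnerSelf_sub] at h2
  linarith

end Spectral
end SubspaceFramework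

namespace SubspaceFramework

/-! ### Compressions, stability of the near-top eigenspace, and the spectral gap -/

section Compression

variable {E : Type*} [NormedAddCommGroup E] [InnerProductSpace ℂ E]

theorem inner_compression (T : E →L[ℂ] E) (V : Submodule ℂ E) [V.HasOrthogonalProjection]
    (v w : V) : inner ℂ (compression T V v) w = inner ℂ (T v) (w : E) := by
  simp only [compression, ContinuousLinearMap.comp_apply, Submodule.subtypeL_apply]
  rw [Submodule.coe_inner, Submodule.coe_orthogonalProjectionOnto_apply,
    Submodule.inner_starProjection_left_eq_right, Submodule.starProjection_eq_self_iff.2 w.2]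

theorem compression_isSymmetric {T : E →L[ℂ] E} (hs : (T : E →ₗ[ℂ] E).IsSymmetric)
    (V : Submodule ℂ E) [V.HasOrthogonalProjection] :
    (compression T V : V →ₗ[ℂ] V).IsSymmetric := by
  intro v w
  have h := hs v w
  simp only [ContinuousLinearMap.coe_coe] at h ⊢
  rw [inner_compression, h, ← inner_conj_symm, ← inner_compression, inner_conj_symm]

theorem compression_isCompactOperator (T : E →L[ℂ] E) (V : Submodule ℂ E)
    [FiniteDimensional ℂ V] : IsCompactOperator (compression T V) :=
  have : ProperSpace V := FiniteDimensional.proper ℂ V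
  isCompactOperator_of_locallyCompactSpace_rng (compression T V)

theorem reApplyInnerSelf_compression (T : E →L[ℂ] E) (V : Submodule ℂ E)
    [V.HasOrthogonalProjection] (v : V) :
    (compression T V).reApplyInnerSelf v = T.reApplyInnerSelf (v : E) := by
  rw [ContinuousLinearMap.reApplyInnerSelf_apply, inner_compression,
    ContinuousLinearMap.reApplyInnerSelf_apply]

variable {T S : E →L[ℂ] E} (hT : (T : E →ₗ[ℂ] E).IsSymmetric)
  (hTc : IsCompactOperator T) (hS : (S : E →ₗ[ℂ] E).IsSymmetric) (hSc : IsCompactOperator S)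
  (V : Submodule ℂ E) [FiniteDimensional ℂ V]

include hT in
theorem reApplyInnerSelf_le_lambdaMax_compression {v : E} (hv : v ∈ V) :
    T.reApplyInnerSelf v ≤ lambdaMax (compression T V) * ‖v‖ ^ 2 := by
  have h := reApplyInnerSelf_le_lambdaMax (compression_isSymmetric hT V)
    (compression_isCompactOperator T V) ⟨v, hv⟩
  rwa [reApplyInnerSelf_compression] at h

include hT hS in
theorem lambdaMax_compression_le_add_norm_sub [Nontrivial V] :
    lambdaMax (compression T V) ≤ lambdaMax (compression S V) + ‖T - S‖ := by
  refine lambdaMax_le (compression_isSymmetric hT V) (compression_isCompactOperator T V) fun v => ?_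
  rw [reApplyInnerSelf_compression]
  have h1 := reApplyInnerSelf_le_lambdaMax_compression hS V v.2
  have h2 := (le_abs_self _).trans (abs_reApplyInnerSelf_le (T - S) (v : E))
  rw [reApplyInnerSelf_sub] at h2
  rw [Submodule.coe_norm]
  linarith

variable [CompleteSpace E]

include hT hTc in
theorem lambdaMax_compression_le [Nontrivial V] : lambdaMax (compression T V) ≤ lambdaMax T := by
  refine lambdaMax_le (compression_isSymmetric hT V) (compression_isCompactOperator T V) fun v => ?_
  rw [reApplyInnerSelf_compression]
  exact reApplyInnerSelf_le_lambdaMax hT hTc (v : E)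

include hT hTc in
theorem lambdaMax_le_lambdaMax_compression [Nontrivial E] {ε : ℝ} (hε : 0 < ε)
    (hV : nearTopEigenspace T ε ≤ V) : lambdaMax T ≤ lambdaMax (compression T V) := by
  refine le_of_forall_pos_lt_add fun η hη => ?_
  obtain ⟨t, ht, v, hv, hv1⟩ := exists_unit_eigenvector hT hTc (lt_min hη hε)
  have htε : lambdaMax T - t ≤ ε := by linarith [min_le_right η ε]
  have h := reApplyInnerSelf_le_lambdaMax_compression hT V
    (hV (eigenspace_le_eigenspaceSum T (J := {t | lambdaMax T - t ≤ ε}) htε hv))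
  rw [reApplyInnerSelf_eq_of_mem_eigenspace hv, hv1] at h
  linarith [min_le_left η ε]

include hT hTc in
theorem nearTopEigenspace_ne_bot [Nontrivial E] {ε : ℝ} (hε : 0 < ε) :
    nearTopEigenspace T ε ≠ ⊥ := by
  obtain ⟨t, ht, v, hv, hv1⟩ := exists_unit_eigenvector hT hTc hε
  have htε : lambdaMax T - t ≤ ε := by linarith
  have h := eigenspace_le_eigenspaceSum T (J := {t | lambdaMax T - t ≤ ε}) htε hv
  refine (Submodule.ne_bot_iff _).2 ⟨v, h, fun h0 => ?_⟩
  simp [h0] at hv1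

include hT hTc in
theorem reApplyInnerSelf_le_of_mem_orthogonal_nearTopEigenspace {ε : ℝ} {v : E}
    (hv : v ∈ (nearTopEigenspace T ε)ᗮ) :
    T.reApplyInnerSelf v ≤ (lambdaMax T - ε) * ‖v‖ ^ 2 := by
  refine reApplyInnerSelf_le_of_mem_orthogonal hT hTc (J := {t | lambdaMax T - t ≤ ε})
    (fun t _ h => ?_) hv
  change lambdaMax T - t ≤ ε
  linarith

include hT hTc hS hSc in
-- The projection onto the near-top space of `S` is injective on that of `T`. On a kernel vector the
-- two forms would differ by too much: one `‖T - S‖` pays for the forms, the other for the largest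
-- eigenvalues.
theorem finiteDimensional_nearTopEigenspace [Nontrivial E] {ε ε' : ℝ}
    [FiniteDimensional ℂ (nearTopEigenspace S ε)] (h : 2 * ‖T - S‖ < ε - ε') :
    FiniteDimensional ℂ (nearTopEigenspace T ε') := by
  set F := nearTopEigenspace S ε with hF
  refine FiniteDimensional.of_injective
    ((F.orthogonalProjectionOnto : E →ₗ[ℂ] F).comp (nearTopEigenspace T ε').subtype) ?_
  rw [← LinearMap.ker_eq_bot, Submodule.eq_bot_iff]
  rintro ⟨x, hx⟩ hx0
  have hxF : x ∈ Fᗮ := by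
    rw [← Submodule.orthogonalProjectionOnto_eq_zero_iff]
    simpa using hx0
  have h1 : (lambdaMax T - ε') * ‖x‖ ^ 2 ≤ T.reApplyInnerSelf x :=
    le_reApplyInnerSelf_of_mem_eigenspaceSum hT
      (fun t (ht : lambdaMax T - t ≤ ε') => by linarith) hx
  have h2 := reApplyInnerSelf_le_of_mem_orthogonal_nearTopEigenspace hS hSc hxF
  have h3 := (le_abs_self _).trans (abs_reApplyInnerSelf_le (T - S) x)
  rw [reApplyInnerSelf_sub] at h3
  have h4 := lambdaMax_le_add_norm_sub hS hSc hT hTc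
  rw [norm_sub_rev] at h4
  have h5 : (ε - ε' - 2 * ‖T - S‖) * ‖x‖ ^ 2 ≤ 0 := by nlinarith [sq_nonneg ‖x‖]
  have h6 : ‖x‖ ^ 2 ≤ 0 := nonpos_of_mul_nonpos_right h5 (by linarith)
  have : x = 0 := norm_eq_zero.1 (pow_eq_zero_iff two_ne_zero |>.1 (h6.antisymm (sq_nonneg _)))
  simpa using this

/-- If only finitely many eigenvalues lie near the top, then the top eigenvalue is isolated. -/
theorem exists_gap {ε : ℝ} (hT : (T : E →ₗ[ℂ] E).IsSymmetric) (hTc : IsCompactOperator T)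
    (hε : 0 < ε) [FiniteDimensional ℂ (nearTopEigenspace T ε)] :
    ∃ g > 0, ∀ v ∈ (Module.End.eigenspace (T : E →ₗ[ℂ] E) (lambdaMax T : ℂ))ᗮ,
      T.reApplyInnerSelf v ≤ (lambdaMax T - g) * ‖v‖ ^ 2 := by
  set F := nearTopEigenspace T ε with hF
  -- The restriction to the finite-dimensional `F` has finitely many eigenvalues, hence so does `T`
  -- within `ε` of the top.
  let R : F →ₗ[ℂ] F := (T : E →ₗ[ℂ] E).restrict
    (fun x (hx : x ∈ F) => apply_mem_eigenspaceSum (J := {t | lambdaMax T - t ≤ ε}) hx)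
  have hfin : {t : ℝ | t < lambdaMax T ∧ lambdaMax T - t ≤ ε ∧
      Module.End.HasEigenvalue (T : E →ₗ[ℂ] E) (t : ℂ)}.Finite := by
    refine ((Module.End.finite_hasEigenvalue R).preimage
      (Complex.ofReal_injective.injOn)).subset ?_
    rintro t ⟨-, ht, hev⟩
    obtain ⟨v, hv, hv0⟩ := hev.exists_hasEigenvector
    have hvF : v ∈ F := eigenspace_le_eigenspaceSum T (J := {t | lambdaMax T - t ≤ ε}) ht hv
    refine Module.End.hasEigenvalue_of_hasEigenvector (x := (⟨v, hvF⟩ : F)) ⟨?_, ?_⟩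
    · rw [Module.End.mem_eigenspace_iff] at hv ⊢
      exact Subtype.ext hv
    · exact fun h => hv0 (congrArg Subtype.val h)
  obtain ⟨c, hc, hcF⟩ : ∃ c < lambdaMax T, ∀ t ∈ {t : ℝ | t < lambdaMax T ∧ lambdaMax T - t ≤ ε ∧
      Module.End.HasEigenvalue (T : E →ₗ[ℂ] E) (t : ℂ)}, t ≤ c := by
    have := (hfin.eventually_all (l := 𝓝[<] lambdaMax T) (p := fun t c => t ≤ c)).2 fun t ht =>
      mem_of_superset (Ioo_mem_nhdsLT ht.1) fun c hc => hc.1.le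
    obtain ⟨c, h1, h2⟩ := (this.and self_mem_nhdsWithin).exists
    exact ⟨c, h2, h1⟩
  refine ⟨min ε (lambdaMax T - c), lt_min hε (by linarith), fun v hv => ?_⟩
  refine reApplyInnerSelf_le_of_mem_orthogonal hT hTc (J := {lambdaMax T}) (fun t hev ht => ?_) ?_
  · by_contra hne
    have htl := lt_of_le_of_ne (le_csSup (bddAbove_eigenvalues T) hev) hne
    have := hcF t ⟨htl, by linarith [min_le_left ε (lambdaMax T - c)], hev⟩
    linarith [min_le_right ε (lambdaMax T - c)]
  · simpa [eigenspaceSum] using hv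

end Compression
end SubspaceFramework

namespace SubspaceFramework

/-! ### Convergence of the iterates -/

namespace IsSubspaceProcedure

variable {E : Type*} [NormedAddCommGroup E] [InnerProductSpace ℂ E]
  {A : ℝ → E →L[ℂ] E} {Ω : Set ℝ} {ε : ℝ} {ω : ℕ → ℝ} {V : ℕ → Submodule ℂ E}
  (h : IsSubspaceProcedure A Ω ε ω V)

include h

theorem mem (k : ℕ) : ω k ∈ Ω := by
  cases k with
  | zero => exact h.init_mem
  | succ k => exact h.step_mem k

theorem monotone : Monotone V :=
  monotone_nat_of_le_succ fun k => by rw [h.step_subspace k]; exact le_sup_left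

theorem nearTopEigenspace_le {l k : ℕ} (hlk : l ≤ k) : nearTopEigenspace (A (ω l)) ε ≤ V k := by
  refine le_trans ?_ (h.monotone hlk)
  cases l with
  | zero => exact h.init_subspace.ge
  | succ l => rw [h.step_subspace l]; exact le_sup_right

theorem finiteDimensional_nearTopEigenspace (k : ℕ) :
    FiniteDimensional ℂ (nearTopEigenspace (A (ω k)) ε) :=
  have := h.finiteDimensional k
  Submodule.finiteDimensional_of_le (h.nearTopEigenspace_le le_rfl)

variable [CompleteSpace E] [Nontrivial E] (hs : ∀ x, (A x : E →ₗ[ℂ] E).IsSymmetric)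
  (hc : ∀ x, IsCompactOperator (A x)) (hε : 0 < ε)

include hs hc hε

theorem nontrivial (k : ℕ) : Nontrivial (V k) :=
  Submodule.nontrivial_iff_ne_bot.2 fun h0 => nearTopEigenspace_ne_bot (hs (ω k)) (hc (ω k)) hε
    (eq_bot_iff.2 (h0 ▸ h.nearTopEigenspace_le le_rfl))

theorem lambdaMax_compression_step_le (k : ℕ) {x : ℝ} (hx : x ∈ Ω) :
    haveI := h.finiteDimensional k
    lambdaMax (compression (A (ω (k + 1))) (V k)) ≤ lambdaMax (A x) :=
  have := h.finiteDimensional k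
  have := h.nontrivial hs hc hε k
  (h.step_isMinOn k hx).trans (lambdaMax_compression_le (hs x) (hc x) (V k))

/-- `V m` contains the near-top space at `ω l`, so compression loses nothing there; moving to `ω (m
+ 1)` costs the norm, and there minimality applies. -/
theorem lambdaMax_iterate_le {l m : ℕ} (hlm : l ≤ m) {x : ℝ} (hx : x ∈ Ω) :
    lambdaMax (A (ω l)) ≤ lambdaMax (A x) + ‖A (ω l) - A (ω (m + 1))‖ := by
  have := h.finiteDimensional m
  have := h.nontrivial hs hc hε m
  have h1 := lambdaMax_le_lambdaMax_compression (hs (ω l)) (hc (ω l)) (V m) hε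
    (h.nearTopEigenspace_le hlm)
  have h2 := lambdaMax_compression_le_add_norm_sub (hs (ω l)) (hs (ω (m + 1))) (V m)
  have h3 := h.lambdaMax_compression_step_le hs hc hε m hx
  linarith

/-- The iterates of the subspace procedure converge to a unique global minimizer. -/
theorem tendsto (hΩ : IsCompact Ω) (hA : ContinuousOn A Ω) {x₀ : ℝ} (hx₀ : x₀ ∈ Ω)
    (hmin : ∀ x ∈ Ω, x ≠ x₀ → lambdaMax (A x₀) < lambdaMax (A x)) :
    Tendsto ω atTop (𝓝 x₀) := by
  refine tendsto_of_subseq_tendsto fun ns hns => ?_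
  obtain ⟨ψ, -, hψ⟩ := strictMono_subseq_of_tendsto_atTop hns
  obtain ⟨y, hy, φ, hφ, hlim⟩ := hΩ.tendsto_subseq fun n => h.mem (ns (ψ n))
  have hmono : StrictMono fun n => ns (ψ (φ n)) := hψ.comp hφ
  suffices y = x₀ from ⟨ψ ∘ φ, this ▸ hlim⟩
  by_contra hne
  have hAlim : Tendsto (fun n => A (ω (ns (ψ (φ n))))) atTop (𝓝 (A y)) :=
    (hA y hy).tendsto.comp (tendsto_nhdsWithin_iff.2 ⟨hlim, Eventually.of_forall fun n => h.mem _⟩)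
  -- Consecutive terms of the subsequence play the roles of `ω l` and `ω (m + 1)`; strict
  -- monotonicity of the indices gives `l ≤ m`.
  have hbound (n : ℕ) : lambdaMax (A y) ≤ lambdaMax (A x₀) +
      (‖A (ω (ns (ψ (φ n)))) - A (ω (ns (ψ (φ (n + 1)))))‖ + ‖A y - A (ω (ns (ψ (φ n))))‖) := by
    obtain ⟨m, hm⟩ := Nat.exists_eq_succ_of_ne_zero
      (Nat.ne_zero_of_lt (hmono (Nat.lt_succ_self n)))
    have hlm : ns (ψ (φ n)) ≤ m := Nat.lt_succ_iff.1 (hm ▸ hmono (Nat.lt_succ_self n))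
    have h1 := h.lambdaMax_iterate_le hs hc hε hlm hx₀
    have h2 := lambdaMax_le_add_norm_sub (hs y) (hc y) (hs (ω (ns (ψ (φ n))))) (hc _)
    simp only [Nat.succ_eq_add_one] at hm
    rw [hm]
    linarith
  have hz : Tendsto (fun n => lambdaMax (A x₀) + (‖A (ω (ns (ψ (φ n)))) -
      A (ω (ns (ψ (φ (n + 1)))))‖ + ‖A y - A (ω (ns (ψ (φ n))))‖)) atTop
      (𝓝 (lambdaMax (A x₀) + (‖A y - A y‖ + ‖A y - A y‖))) :=
    tendsto_const_nhds.add (((hAlim.sub (hAlim.comp (tendsto_add_atTop_nat 1))).norm).add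
      (tendsto_const_nhds.sub hAlim).norm)
  have := ge_of_tendsto' hz hbound
  simp only [sub_self, norm_zero, add_zero] at this
  exact absurd this (not_le.2 (hmin y hy hne))

end IsSubspaceProcedure
end SubspaceFramework

namespace SubspaceFramework

/-! ### One-sided minima and the Clarke derivative -/

section Clarke

variable {g : ℝ → ℝ} {x₀ : ℝ}

theorem deriv_le_of_slope_le {s : Set ℝ} {θ u : ℝ} (hu : s ∈ 𝓝 u)
    (hup : ∀ x ∈ s, ∀ y ∈ s, x < y → g y - g x ≤ θ * (y - x)) (hd : DifferentiableAt ℝ g u) :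
    deriv g u ≤ θ := by
  have h1 := (hasDerivWithinAt_iff_tendsto_slope' (s := Ioi u) (by simp)).1
    hd.hasDerivAt.hasDerivWithinAt
  refine le_of_tendsto h1 ?_
  filter_upwards [self_mem_nhdsWithin, mem_nhdsWithin_of_mem_nhds hu] with y hy hys
  rw [slope_def_field, div_le_iff₀ (sub_pos.2 hy)]
  exact hup u (mem_of_mem_nhds hu) y hys hy

/-- A Lipschitz function is the integral of its derivative; a derivative below `-θ` almost
everywhere would force `g b < g a`. -/
theorem exists_neg_le_deriv {K : NNReal} {a b θ : ℝ} (hab : a < b)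
    (hLip : LipschitzOnWith K g (Icc a b)) (hg : g a ≤ g b) (hθ : 0 < θ) :
    ∃ u ∈ Ioo a b, DifferentiableAt ℝ g u ∧ -θ ≤ deriv g u := by
  by_contra! hcon
  rw [← uIcc_of_le hab.le] at hLip
  have hac := hLip.absolutelyContinuousOnInterval
  have hint := hac.integral_deriv_eq_sub
  have hle : ∫ x in a..b, deriv g x ≤ ∫ _ in a..b, -θ := by
    refine intervalIntegral.integral_mono_ae_restrict hab.le hac.intervalIntegrable_deriv
      intervalIntegrable_const ?_
    rw [MeasureTheory.Measure.restrict_congr_set MeasureTheory.Ioo_ae_eq_Icc.symm]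
    refine (MeasureTheory.ae_restrict_iff' measurableSet_Ioo).2 ?_
    filter_upwards [hac.ae_differentiableAt] with u hu hmem
    exact (hcon u hmem (hu (uIcc_of_le hab.le ▸ Ioo_subset_Icc_self hmem))).le
  rw [hint, intervalIntegral.integral_const, smul_eq_mul] at hle
  nlinarith [mul_pos (sub_pos.2 hab) hθ]

/-- The slope bounds put the Clarke derivative inside `Iic 0`. The minimum on the right supplies
derivatives in `[-θ, θ]` arbitrarily near `x₀`, so zero belongs to it and is its largest element. -/
theorem zero_mem_frontier_clarkeDeriv
    (hLip : ∃ K, ∃ s ∈ 𝓝 x₀, LipschitzOnWith K g s)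
    (hup : ∀ θ > 0, ∃ s ∈ 𝓝 x₀, ∀ x ∈ s, ∀ y ∈ s, x < y → g y - g x ≤ θ * (y - x))
    (hmin : ∀ᶠ y in 𝓝[>] x₀, g x₀ ≤ g y) :
    (0 : ℝ) ∈ frontier (clarkeDeriv g x₀) := by
  have hsub : clarkeDeriv g x₀ ⊆ Iic 0 := by
    refine convexHull_min ?_ (convex_Iic (𝕜 := ℝ) (0 : ℝ))
    rintro d ⟨u, hu, hdiff, hlim⟩
    refine le_of_forall_pos_le_add (α := ℝ) fun θ hθ => ?_
    obtain ⟨s, hs, hsθ⟩ := hup θ hθ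
    rw [zero_add]
    refine le_of_tendsto hlim ?_
    filter_upwards [hu.eventually (eventually_mem_nhds_iff.2 hs)] with n hn
    exact deriv_le_of_slope_le hn hsθ (hdiff n)
  have hex (θ : ℝ) (hθ : 0 < θ) :
      ∃ u, |u - x₀| ≤ θ ∧ DifferentiableAt ℝ g u ∧ |deriv g u| ≤ θ := by
    obtain ⟨K, s, hs, hK⟩ := hLip
    obtain ⟨t, ht, htθ⟩ := hup θ hθ
    obtain ⟨r, hr, hrst⟩ := Metric.nhds_basis_closedBall.mem_iff.1 (inter_mem hs ht)
    obtain ⟨y, hy, hxy, hyr⟩ := (hmin.and (Ioo_mem_nhdsGT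
      (show x₀ < x₀ + min r θ by linarith [lt_min hr hθ]))).exists
    have hball (z : ℝ) (h1 : x₀ ≤ z) (h2 : z ≤ y) : z ∈ s ∩ t := by
      refine hrst ?_
      rw [Metric.mem_closedBall, Real.dist_eq, abs_of_nonneg (by linarith)]
      linarith [min_le_left r θ]
    obtain ⟨u, ⟨hu1, hu2⟩, hud, hu⟩ := exists_neg_le_deriv hxy
      (hK.mono fun z hz => (hball z hz.1 hz.2).1) hy hθ
    refine ⟨u, ?_, hud, abs_le.2 ⟨hu, deriv_le_of_slope_le (s := Ioo x₀ y)
      (Ioo_mem_nhds hu1 hu2) (fun p hp q hq => htθ p (hball p hp.1.le hp.2.le).2 q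
        (hball q hq.1.le hq.2.le).2) hud⟩⟩
    rw [abs_of_nonneg (by linarith)]
    linarith [min_le_right r θ]
  have h0 : (0 : ℝ) ∈ clarkeDeriv g x₀ := by
    choose u hu1 hu2 hu3 using fun n : ℕ => hex (1 / ((n : ℝ) + 1)) Nat.one_div_pos_of_nat
    refine subset_convexHull ℝ _ ⟨u, ?_, hu2, ?_⟩
    · rw [tendsto_iff_norm_sub_tendsto_zero]
      exact squeeze_zero (fun _ => norm_nonneg _) hu1 tendsto_one_div_add_atTop_nhds_zero_nat
    · exact squeeze_zero_norm hu3 tendsto_one_div_add_atTop_nhds_zero_nat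
  refine ⟨subset_closure h0, fun hi => ?_⟩
  have := interior_mono hsub hi
  simp at this

theorem clarkeDeriv_comp_neg (g : ℝ → ℝ) (x₀ : ℝ) :
    clarkeDeriv (fun x => g (-x)) (-x₀) = -clarkeDeriv g x₀ := by
  have key (g : ℝ → ℝ) (x₀ d : ℝ) (h : ∃ u : ℕ → ℝ, Tendsto u atTop (𝓝 x₀) ∧
      (∀ n, DifferentiableAt ℝ g (u n)) ∧ Tendsto (fun n => deriv g (u n)) atTop (𝓝 d)) :
      ∃ u : ℕ → ℝ, Tendsto u atTop (𝓝 (-x₀)) ∧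
        (∀ n, DifferentiableAt ℝ (fun x => g (-x)) (u n)) ∧
        Tendsto (fun n => deriv (fun x => g (-x)) (u n)) atTop (𝓝 (-d)) := by
    obtain ⟨u, hu, hd, hlim⟩ := h
    refine ⟨fun n => -u n, hu.neg, fun n => ?_, ?_⟩
    · have hn : DifferentiableAt ℝ g (- -u n) := by simpa using hd n
      exact hn.comp (-u n) differentiableAt_id.neg
    · simpa [deriv_comp_neg] using hlim.neg
  rw [clarkeDeriv, clarkeDeriv, ← convexHull_neg]
  congr 1
  ext d
  constructor
  · intro h
    have := key _ _ _ h
    simp only [neg_neg] at this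
    exact this
  · intro h
    have := key _ _ _ h
    rwa [neg_neg] at this

theorem zero_mem_frontier_clarkeDeriv_comp_neg
    (h : (0 : ℝ) ∈ frontier (clarkeDeriv (fun x => g (-x)) (-x₀))) :
    (0 : ℝ) ∈ frontier (clarkeDeriv g x₀) := by
  rw [clarkeDeriv_comp_neg] at h
  have h2 := (Homeomorph.neg ℝ).preimage_frontier (clarkeDeriv g x₀)
  rw [Homeomorph.coe_neg, Set.neg_preimage, Set.neg_preimage] at h2
  rw [← h2] at h
  simpa using h

end Clarke
end SubspaceFramework

namespace SubspaceFramework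

/-! ### First-order perturbation of the top eigenvalue and eigenspace -/

section Perturbation

variable {E : Type*} [NormedAddCommGroup E] [InnerProductSpace ℂ E]

theorem reApplyInnerSelf_real_smul (c : ℝ) (T : E →L[ℂ] E) (v : E) :
    (c • T).reApplyInnerSelf v = c * T.reApplyInnerSelf v := by
  rw [ContinuousLinearMap.reApplyInnerSelf_apply, ContinuousLinearMap.reApplyInnerSelf_apply,
    smul_apply, ← Complex.coe_smul, inner_smul_left, Complex.conj_ofReal]
  exact Complex.re_ofReal_mul _ _

theorem abs_reApplyInnerSelf_sub_le (T : E →L[ℂ] E) (v w : E) :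
    |T.reApplyInnerSelf v - T.reApplyInnerSelf w| ≤ ‖T‖ * ‖v - w‖ * (‖v‖ + ‖w‖) := by
  have h : T.reApplyInnerSelf v - T.reApplyInnerSelf w =
      RCLike.re (inner ℂ (T (v - w)) v + inner ℂ (T w) (v - w)) := by
    simp only [ContinuousLinearMap.reApplyInnerSelf_apply, map_sub, inner_sub_left, inner_sub_right,
      map_add]
    ring
  rw [h]
  refine (RCLike.abs_re_le_norm _).trans ((norm_add_le _ _).trans ?_)
  have h1 : ‖inner ℂ (T (v - w)) v‖ ≤ ‖T‖ * ‖v - w‖ * ‖v‖ :=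
    (norm_inner_le_norm _ _).trans (by gcongr; exact T.le_opNorm _)
  have h2 : ‖inner ℂ (T w) (v - w)‖ ≤ ‖T‖ * ‖w‖ * ‖v - w‖ :=
    (norm_inner_le_norm _ _).trans (by gcongr; exact T.le_opNorm _)
  linarith

/-- The form of `t - T` has no cross terms with `e`, which `t - T` annihilates. This is the source
of the square in the rate. -/
theorem reApplyInnerSelf_add_of_mem_eigenspace {T : E →L[ℂ] E}
    (hT : (T : E →ₗ[ℂ] E).IsSymmetric) {t : ℝ} {e : E}
    (he : e ∈ Module.End.eigenspace (T : E →ₗ[ℂ] E) (t : ℂ)) (r : E) :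
    t * ‖e + r‖ ^ 2 - T.reApplyInnerSelf (e + r) = t * ‖r‖ ^ 2 - T.reApplyInnerSelf r := by
  have he' : T e = (t : ℂ) • e := Module.End.mem_eigenspace_iff.1 he
  have h1 : inner ℂ (T r) e = (t : ℂ) * inner ℂ r e := by
    rw [show inner ℂ (T r) e = inner ℂ r (T e) from hT r e, he', inner_smul_right]
  have h2 : RCLike.re (inner ℂ r e) = RCLike.re (inner ℂ e r) := inner_re_symm _ _
  have h3 (z : ℂ) : RCLike.re ((t : ℂ) * z) = t * RCLike.re z := Complex.re_ofReal_mul _ _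
  rw [ContinuousLinearMap.reApplyInnerSelf_apply, ContinuousLinearMap.reApplyInnerSelf_apply,
    map_add, inner_add_left, inner_add_right, inner_add_right, h1, he', inner_smul_left,
    inner_smul_left, Complex.conj_ofReal, map_add, map_add, map_add, h3, h3, h3, h2,
    inner_self_eq_norm_sq, norm_add_sq (𝕜 := ℂ)]
  ring

/-- If `B` is nonpositive on an isolated top eigenspace of `T`, then it is almost nonpositive on
the unit vectors that almost attain the top eigenvalue. -/
theorem exists_reApplyInnerSelf_le {T B : E →L[ℂ] E} (hT : (T : E →ₗ[ℂ] E).IsSymmetric)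
    {t g : ℝ} (hg : 0 < g)
    [(Module.End.eigenspace (T : E →ₗ[ℂ] E) (t : ℂ)).HasOrthogonalProjection]
    (hgap : ∀ v ∈ (Module.End.eigenspace (T : E →ₗ[ℂ] E) (t : ℂ))ᗮ,
      T.reApplyInnerSelf v ≤ (t - g) * ‖v‖ ^ 2)
    (hB : ∀ e ∈ Module.End.eigenspace (T : E →ₗ[ℂ] E) (t : ℂ), B.reApplyInnerSelf e ≤ 0)
    {θ : ℝ} (hθ : 0 < θ) :
    ∃ ζ > 0, ∀ v, ‖v‖ = 1 → t - ζ ≤ T.reApplyInnerSelf v → B.reApplyInnerSelf v ≤ θ := by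
  have hB0 := norm_nonneg B
  -- The defect `ζ = g * s ^ 2` forces `v` within `s` of the eigenspace, and then the form of `B`
  -- changes by at most `2 * ‖B‖ * s ≤ θ`.
  set s := θ / (2 * (‖B‖ + 1)) with hs
  have hs0 : 0 < s := by positivity
  refine ⟨g * s ^ 2, by positivity, fun v hv1 hv => ?_⟩
  set F := Module.End.eigenspace (T : E →ₗ[ℂ] E) (t : ℂ) with hF
  set e := F.starProjection v with he
  have heF : e ∈ F := F.starProjection_apply_mem v
  have hr : v - e ∈ Fᗮ := F.sub_starProjection_mem_orthogonal v
  have h1 := reApplyInnerSelf_add_of_mem_eigenspace hT heF (v - e)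
  rw [add_sub_cancel, hv1] at h1
  have h2 := hgap _ hr
  have h3 : g * ‖v - e‖ ^ 2 ≤ g * s ^ 2 := by linarith
  have h4 : ‖v - e‖ ≤ s := le_of_sq_le_sq (le_of_mul_le_mul_left h3 hg) hs0.le
  have h5 : ‖e‖ ≤ 1 := hv1 ▸ F.norm_starProjection_apply_le v
  have h6 := (le_abs_self _).trans (abs_reApplyInnerSelf_sub_le B v e)
  have h7 : ‖B‖ * ‖v - e‖ * (‖v‖ + ‖e‖) ≤ ‖B‖ * s * (1 + 1) := by rw [hv1]; gcongr
  have h8 : (‖B‖ + 1) * s * 2 = θ := by rw [hs]; field_simp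
  linarith [hB e heF]

theorem exists_norm_sub_sub_smul_le {F : Type*} [NormedAddCommGroup F] [NormedSpace ℝ F]
    {A : ℝ → F} {B : F} {x₀ : ℝ} (hA : HasStrictDerivAt A B x₀) {c : ℝ} (hc : 0 < c) :
    ∃ s ∈ 𝓝 x₀, ∀ x ∈ s, ∀ y ∈ s, ‖A x - A y - (x - y) • B‖ ≤ c * ‖x - y‖ := by
  have h : ∀ᶠ p : ℝ × ℝ in 𝓝 (x₀, x₀), ‖A p.1 - A p.2 - (p.1 - p.2) • B‖ ≤ c * ‖p.1 - p.2‖ :=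
    (hasStrictFDerivAt_iff_isLittleO.1 hA.hasStrictFDerivAt).bound hc
  rw [nhds_prod_eq] at h
  obtain ⟨s, hs1, hs2⟩ := mem_prod_same_iff.1 h
  exact ⟨s, hs1, fun x hx y hy => hs2 (mk_mem_prod hx hy)⟩

theorem hasStrictDerivAt_comp_neg {F : Type*} [NormedAddCommGroup F] [NormedSpace ℝ F]
    {A : ℝ → F} {B : F} {x₀ : ℝ} (hA : HasStrictDerivAt A B (- -x₀)) :
    HasStrictDerivAt (fun x => A (-x)) (-B) (-x₀) := by
  have := hA.scomp (-x₀) (hasStrictDerivAt_neg (-x₀))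
  rwa [neg_one_smul] at this

variable [CompleteSpace E]

/-- A Davis–Kahan type estimate. For the residual `r = e - v`, invariance of `F` under `S` gives
`⟨(λ - S) r, r⟩ = ⟨(T - S) e, r⟩` with `λ = lambdaMax T`; the left side is at least `ε / 2 * ‖r‖ ^
2`, since `S` lies `ε` below its top on `Fᗮ` and the tops differ by at most `ε / 2`. -/
theorem norm_sub_starProjection_le [Nontrivial E] {T S : E →L[ℂ] E}
    (hT : (T : E →ₗ[ℂ] E).IsSymmetric)
    (hTc : IsCompactOperator T) (hS : (S : E →ₗ[ℂ] E).IsSymmetric) (hSc : IsCompactOperator S)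
    {ε : ℝ} (hε : 0 < ε) [(nearTopEigenspace S ε).HasOrthogonalProjection]
    (hTS : ‖T - S‖ ≤ ε / 2) {e : E}
    (he : e ∈ Module.End.eigenspace (T : E →ₗ[ℂ] E) (lambdaMax T : ℂ)) :
    ‖e - (nearTopEigenspace S ε).starProjection e‖ ≤ 2 / ε * (‖T - S‖ * ‖e‖) := by
  set F := nearTopEigenspace S ε with hF
  set v := F.starProjection e with hv
  have hvF : v ∈ F := F.starProjection_apply_mem e
  have hr : e - v ∈ Fᗮ := F.sub_starProjection_mem_orthogonal e
  have he' : T e = (lambdaMax T : ℂ) • e := Module.End.mem_eigenspace_iff.1 he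
  have h1 := reApplyInnerSelf_le_of_mem_orthogonal_nearTopEigenspace hS hSc hr
  have h2 := lambdaMax_le_add_norm_sub hS hSc hT hTc
  rw [norm_sub_rev] at h2
  have hSv : S v ∈ F := apply_mem_eigenspaceSum (J := {t | lambdaMax S - t ≤ ε}) hvF
  have h3 : lambdaMax T * ‖e - v‖ ^ 2 - S.reApplyInnerSelf (e - v) =
      RCLike.re (inner ℂ ((T - S) e) (e - v)) := by
    have h4 : (T - S) e = ((lambdaMax T : ℂ) • (e - v) - S (e - v)) +
        ((lambdaMax T : ℂ) • v - S v) := by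
      simp only [sub_apply, he', map_sub, smul_sub]
      abel
    rw [h4, inner_add_left, Submodule.inner_right_of_mem_orthogonal
      (F.sub_mem (F.smul_mem _ hvF) hSv) hr, add_zero, inner_sub_left, inner_ofReal_smul_self,
      map_sub, ContinuousLinearMap.reApplyInnerSelf_apply]
    congr 1
  have h5 : RCLike.re (inner ℂ ((T - S) e) (e - v)) ≤ ‖T - S‖ * ‖e‖ * ‖e - v‖ :=
    (RCLike.re_le_norm _).trans ((norm_inner_le_norm _ _).trans
      (by gcongr; exact (T - S).le_opNorm e))
  rcases (norm_nonneg (e - v)).eq_or_lt with h0 | h0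
  · rw [← h0]
    positivity
  · have h6 : ε / 2 * ‖e - v‖ * ‖e - v‖ ≤ ‖T - S‖ * ‖e‖ * ‖e - v‖ := by
      nlinarith [sq_nonneg ‖e - v‖]
    have h7 := le_of_mul_le_mul_right h6 h0
    calc ‖e - v‖ = 2 / ε * (ε / 2 * ‖e - v‖) := by field_simp
      _ ≤ _ := by gcongr

variable [Nontrivial E] {A : ℝ → E →L[ℂ] E} {B : E →L[ℂ] E} {x₀ : ℝ}
  (hs : ∀ x, (A x : E →ₗ[ℂ] E).IsSymmetric) (hc : ∀ x, IsCompactOperator (A x))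
  (hA : HasStrictDerivAt A B x₀)

include hs hc hA

theorem exists_lipschitzOnWith_lambdaMax :
    ∃ K, ∃ s ∈ 𝓝 x₀, LipschitzOnWith K (fun x => lambdaMax (A x)) s := by
  obtain ⟨K, s, hs', hK⟩ := hA.hasStrictFDerivAt.exists_lipschitzOnWith
  refine ⟨K, s, hs', LipschitzOnWith.of_dist_le_mul fun x hx y hy => ?_⟩
  have h := hK.dist_le_mul x hx y hy
  rw [dist_eq_norm] at h
  rw [Real.dist_eq, abs_le]
  have h1 := lambdaMax_le_add_norm_sub (hs x) (hc x) (hs y) (hc y)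
  have h2 := lambdaMax_le_add_norm_sub (hs y) (hc y) (hs x) (hc x)
  rw [norm_sub_rev] at h2
  constructor <;> linarith

/-- A near-top eigenvector at `y` is a test vector at `x`, so the increment is at most `⟨(A y - A x)
v, v⟩` up to `η`. As `v` almost attains the top at `x₀`, its slope is at most `θ / 2`; strict
differentiability makes the remainder uniform in `x` and `y`. -/
theorem exists_lambdaMax_sub_le {g : ℝ} (hg : 0 < g)
    [(Module.End.eigenspace (A x₀ : E →ₗ[ℂ] E) (lambdaMax (A x₀) : ℂ)).HasOrthogonalProjection]
    (hgap : ∀ v ∈ (Module.End.eigenspace (A x₀ : E →ₗ[ℂ] E) (lambdaMax (A x₀) : ℂ))ᗮ,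
      (A x₀).reApplyInnerSelf v ≤ (lambdaMax (A x₀) - g) * ‖v‖ ^ 2)
    (hB : ∀ e ∈ Module.End.eigenspace (A x₀ : E →ₗ[ℂ] E) (lambdaMax (A x₀) : ℂ),
      B.reApplyInnerSelf e ≤ 0) {θ : ℝ} (hθ : 0 < θ) :
    ∃ s ∈ 𝓝 x₀, ∀ x ∈ s, ∀ y ∈ s, x < y →
      lambdaMax (A y) - lambdaMax (A x) ≤ θ * (y - x) := by
  obtain ⟨ζ, hζ, hζB⟩ := exists_reApplyInnerSelf_le (hs x₀) hg hgap hB (half_pos hθ)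
  obtain ⟨s, hs1, hs2⟩ := exists_norm_sub_sub_smul_le hA (half_pos hθ)
  -- Of the tolerance `ζ`, the choice of `v` uses one half; exchanging `A y` for `A x₀` uses one
  -- quarter in the form and one in the largest eigenvalue.
  have h2 : ∀ᶠ y in 𝓝 x₀, ‖A x₀ - A y‖ < ζ / 4 := by
    have : Tendsto (fun y => ‖A x₀ - A y‖) (𝓝 x₀) (𝓝 ‖A x₀ - A x₀‖) :=
      (tendsto_const_nhds.sub hA.hasDerivAt.continuousAt.tendsto).norm
    exact this.eventually_lt_const (by simpa using by positivity)
  refine ⟨_, inter_mem hs1 h2, fun x hx y hy hxy => le_of_forall_pos_le_add fun η hη => ?_⟩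
  obtain ⟨t, ht, v, hv, hv1⟩ := exists_unit_eigenvector (hs y) (hc y) (lt_min hη (half_pos hζ))
  have hvt := reApplyInnerSelf_eq_of_mem_eigenspace hv
  have h3 := (le_abs_self _).trans (abs_reApplyInnerSelf_le (A y - A x₀) v)
  rw [norm_sub_rev, reApplyInnerSelf_sub] at h3
  have h4 := lambdaMax_le_add_norm_sub (hs x₀) (hc x₀) (hs y) (hc y)
  have h5 : ‖A x₀ - A y‖ < ζ / 4 := hy.2
  have h6 := reApplyInnerSelf_le_lambdaMax (hs x) (hc x) v
  rw [hv1] at hvt h3 h6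
  have h7 := hζB v hv1 (by linarith [min_le_right η (ζ / 2)])
  have h8 : ‖A y - A x - (y - x) • B‖ ≤ θ / 2 * ‖y - x‖ := hs2 y hy.1 x hx.1
  have h9 := (le_abs_self _).trans (abs_reApplyInnerSelf_le (A y - A x - (y - x) • B) v)
  rw [reApplyInnerSelf_sub, reApplyInnerSelf_sub, reApplyInnerSelf_real_smul, hv1] at h9
  rw [Real.norm_of_nonneg (sub_pos.2 hxy).le] at h8
  have h10 := mul_le_mul_of_nonneg_left h7 (sub_pos.2 hxy).le
  linarith [min_le_left η (ζ / 2)]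

/-- If the top eigenvalue does not decrease to the right of `x₀` and zero is no boundary point of
its generalized derivative, then some top eigenvector has a positive slope. -/
theorem exists_pos_reApplyInnerSelf {g : ℝ} (hg : 0 < g)
    [(Module.End.eigenspace (A x₀ : E →ₗ[ℂ] E) (lambdaMax (A x₀) : ℂ)).HasOrthogonalProjection]
    (hgap : ∀ v ∈ (Module.End.eigenspace (A x₀ : E →ₗ[ℂ] E) (lambdaMax (A x₀) : ℂ))ᗮ,
      (A x₀).reApplyInnerSelf v ≤ (lambdaMax (A x₀) - g) * ‖v‖ ^ 2)
    (hmin : ∀ᶠ y in 𝓝[>] x₀, lambdaMax (A x₀) ≤ lambdaMax (A y))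
    (h0 : (0 : ℝ) ∉ frontier (clarkeDeriv (fun x => lambdaMax (A x)) x₀)) :
    ∃ e ∈ Module.End.eigenspace (A x₀ : E →ₗ[ℂ] E) (lambdaMax (A x₀) : ℂ),
      0 < B.reApplyInnerSelf e := by
  by_contra! hB
  exact h0 (zero_mem_frontier_clarkeDeriv (exists_lipschitzOnWith_lambdaMax hs hc hA)
    (fun θ hθ => exists_lambdaMax_sub_le hs hc hA hg hgap hB hθ) hmin)

/-- Reflection `x ↦ -x` turns the left side into the right one and `B` into `-B`. -/
theorem exists_neg_reApplyInnerSelf {g : ℝ} (hg : 0 < g)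
    [(Module.End.eigenspace (A x₀ : E →ₗ[ℂ] E) (lambdaMax (A x₀) : ℂ)).HasOrthogonalProjection]
    (hgap : ∀ v ∈ (Module.End.eigenspace (A x₀ : E →ₗ[ℂ] E) (lambdaMax (A x₀) : ℂ))ᗮ,
      (A x₀).reApplyInnerSelf v ≤ (lambdaMax (A x₀) - g) * ‖v‖ ^ 2)
    (hmin : ∀ᶠ y in 𝓝[<] x₀, lambdaMax (A x₀) ≤ lambdaMax (A y))
    (h0 : (0 : ℝ) ∉ frontier (clarkeDeriv (fun x => lambdaMax (A x)) x₀)) :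
    ∃ e ∈ Module.End.eigenspace (A x₀ : E →ₗ[ℂ] E) (lambdaMax (A x₀) : ℂ),
      B.reApplyInnerSelf e < 0 := by
  rw [← neg_neg x₀] at hA
  have hA' := hasStrictDerivAt_comp_neg hA
  have hmin' : ∀ᶠ y in 𝓝[>] (-x₀), lambdaMax (A (- -x₀)) ≤ lambdaMax (A (-y)) := by
    rw [neg_neg]
    have : Tendsto (fun y : ℝ => -y) (𝓝[>] (-x₀)) (𝓝[<] x₀) := by
      simpa using tendsto_neg_nhdsGT (a := -x₀)
    exact this.eventually hmin
  obtain ⟨y, rfl⟩ : ∃ y, x₀ = -y := ⟨-x₀, (neg_neg x₀).symm⟩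
  simp only [neg_neg] at hA' hmin'
  obtain ⟨e, he, hpos⟩ := exists_pos_reApplyInnerSelf (A := fun x => A (-x)) (fun x => hs _)
    (fun x => hc _) hA' hg hgap hmin' fun h => h0
      (zero_mem_frontier_clarkeDeriv_comp_neg (g := fun x => lambdaMax (A x)) (by simpa using h))
  refine ⟨e, he, ?_⟩
  rw [← neg_one_smul ℝ B, reApplyInnerSelf_real_smul] at hpos
  linarith

end Perturbation
end SubspaceFramework

namespace SubspaceFramework

/-! ### Regularity of the operator family -/

section OperatorFamily

variable {E : Type*} [NormedAddCommGroup E] [InnerProductSpace ℂ E] {κ : ℕ}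
  {A : Fin κ → E →L[ℂ] E} {f : Fin κ → ℝ → ℝ}

theorem operatorFamily_isSymmetric (hA : ∀ i, (A i : E →ₗ[ℂ] E).IsSymmetric) (x : ℝ) :
    (operatorFamily f A x : E →ₗ[ℂ] E).IsSymmetric := by
  intro v w
  simp only [operatorFamily, ContinuousLinearMap.coe_coe, sum_apply,
    smul_apply, sum_inner, inner_sum, inner_smul_left, inner_smul_right, Complex.conj_ofReal]
  exact Finset.sum_congr rfl fun i _ => congrArg _ (hA i v w)

theorem operatorFamily_isCompactOperator (hA : ∀ i, IsCompactOperator (A i)) (x : ℝ) :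
    IsCompactOperator (operatorFamily f A x) := by
  have h : operatorFamily f A x ∈ compactOperator (RingHom.id ℂ) E E :=
    Submodule.sum_mem _ fun i _ => Submodule.smul_mem _ _ (hA i)
  exact h

theorem hasStrictDerivAt_operatorFamily {x : ℝ} (hf : ∀ i, AnalyticAt ℝ (f i) x) :
    HasStrictDerivAt (operatorFamily f A) (operatorFamily (fun i => deriv (f i)) A x) x := by
  unfold operatorFamily
  exact HasStrictDerivAt.fun_sum fun i _ =>
    (Complex.ofRealCLM.hasStrictFDerivAt.comp_hasStrictDerivAt x
      (hf i).hasStrictDerivAt).smul_const (A i)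

end OperatorFamily

/-! ### The quadratic rate -/

section Rate

variable {E : Type*} [NormedAddCommGroup E] [InnerProductSpace ℂ E] [CompleteSpace E]
  [Nontrivial E] {A : ℝ → E →L[ℂ] E} {Ω : Set ℝ} {ε : ℝ} {ω : ℕ → ℝ} {V : ℕ → Submodule ℂ E}

theorem IsSubspaceProcedure.reApplyInnerSelf_step_le (h : IsSubspaceProcedure A Ω ε ω V)
    (hs : ∀ x, (A x : E →ₗ[ℂ] E).IsSymmetric) (hc : ∀ x, IsCompactOperator (A x)) (hε : 0 < ε)
    {x₀ : ℝ} (hx₀ : x₀ ∈ Ω) (k : ℕ) {v : E} (hv : v ∈ nearTopEigenspace (A (ω k)) ε) :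
    (A (ω (k + 1))).reApplyInnerSelf v ≤ lambdaMax (A x₀) * ‖v‖ ^ 2 := by
  have := h.finiteDimensional k
  refine (reApplyInnerSelf_le_lambdaMax_compression (hs _) (V k)
    (h.nearTopEigenspace_le le_rfl hv)).trans ?_
  exact mul_le_mul_of_nonneg_right (h.lambdaMax_compression_step_le hs hc hε k hx₀) (sq_nonneg _)

/-- A top eigenvector `e` at the minimizer with a nonzero slope controls the iterates on the side
on which the slope is uphill. -/
theorem IsSubspaceProcedure.exists_abs_sub_le (h : IsSubspaceProcedure A Ω ε ω V)
    (hs : ∀ x, (A x : E →ₗ[ℂ] E).IsSymmetric) (hc : ∀ x, IsCompactOperator (A x)) (hε : 0 < ε)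
    {x₀ : ℝ} (hx₀ : x₀ ∈ Ω) {B : E →L[ℂ] E} (hA : HasStrictDerivAt A B x₀)
    (hω : Tendsto ω atTop (𝓝 x₀)) {e : E}
    (he : e ∈ Module.End.eigenspace (A x₀ : E →ₗ[ℂ] E) (lambdaMax (A x₀) : ℂ)) :
    ∃ C, ∀ᶠ k in atTop, 0 < (ω (k + 1) - x₀) * B.reApplyInnerSelf e →
      |ω (k + 1) - x₀| ≤ C * (ω k - x₀) ^ 2 := by
  set m := |B.reApplyInnerSelf e| with hm
  rcases (abs_nonneg (B.reApplyInnerSelf e)).eq_or_lt with hm0 | hm0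
  · refine ⟨0, Eventually.of_forall fun k hk => ?_⟩
    rw [abs_eq_zero.1 hm0.symm, mul_zero] at hk
    exact absurd hk (lt_irrefl _)
  rw [← hm] at hm0
  set M := |lambdaMax (A x₀)| + ‖A x₀‖ with hM
  have hω1 : Tendsto (fun k => ω (k + 1)) atTop (𝓝 x₀) := hω.comp (tendsto_add_atTop_nat 1)
  obtain ⟨L, hL, hLb⟩ := hA.hasDerivAt.isBigO_sub.exists_pos
  have hAω : Tendsto (fun k => ‖A x₀ - A (ω k)‖) atTop (𝓝 0) := by
    have := (tendsto_const_nhds (x := A x₀)).sub (hA.hasDerivAt.continuousAt.tendsto.comp hω)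
    simpa using this.norm
  -- Linearization and the replacement of `e` by `v` in the slope may each consume `|δ| * (m / 4)`,
  -- leaving `|δ| * (m / 2)` on the left in `h13`.
  set c := m / (4 * (‖e‖ ^ 2 + 1)) with hc'
  have hcpos : 0 < c := by positivity
  obtain ⟨s, hs0, hsc⟩ := exists_norm_sub_sub_smul_le hA hcpos
  have hsmall : ∀ᶠ k in atTop, 2 * ‖B‖ * ‖e‖ * (2 / ε * (‖A x₀ - A (ω k)‖ * ‖e‖)) < m / 4 := by
    have : Tendsto (fun k => 2 * ‖B‖ * ‖e‖ * (2 / ε * (‖A x₀ - A (ω k)‖ * ‖e‖))) atTop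
        (𝓝 (2 * ‖B‖ * ‖e‖ * (2 / ε * (0 * ‖e‖)))) :=
      ((hAω.mul_const _).const_mul _).const_mul _
    exact this.eventually_lt_const (by simpa using by positivity)
  refine ⟨2 / m * (M * (2 / ε * (L * ‖e‖)) ^ 2), ?_⟩
  filter_upwards [hω.eventually hLb.bound, hω1.eventually hs0, hsmall,
    hAω.eventually_le_const (half_pos hε)] with k hk1 hk2 hk3 hk4 hpos
  have := h.finiteDimensional_nearTopEigenspace k
  set F := nearTopEigenspace (A (ω k)) ε with hF
  set v := F.starProjection e with hv
  set δ := ω (k + 1) - x₀ with hδ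
  have hvF : v ∈ F := F.starProjection_apply_mem e
  have hve : ‖v‖ ≤ ‖e‖ := F.norm_starProjection_apply_le e
  have hr := norm_sub_starProjection_le (hs x₀) (hc x₀) (hs (ω k)) (hc (ω k)) hε hk4 he
  rw [norm_sub_rev] at hr
  change ‖v - e‖ ≤ _ at hr
  have hstep := h.reApplyInnerSelf_step_le hs hc hε hx₀ k hvF
  -- The zeroth-order defect of `v` at `x₀` is quadratic in `v - e`.
  have h1 := reApplyInnerSelf_add_of_mem_eigenspace (hs x₀) he (v - e)
  rw [add_sub_cancel] at h1
  have h2 : lambdaMax (A x₀) * ‖v - e‖ ^ 2 - (A x₀).reApplyInnerSelf (v - e) ≤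
      M * ‖v - e‖ ^ 2 := by
    have h3 := (neg_le_abs _).trans (abs_reApplyInnerSelf_le (A x₀) (v - e))
    have h4 := mul_le_mul_of_nonneg_right (le_abs_self (lambdaMax (A x₀))) (sq_nonneg ‖v - e‖)
    rw [hM, add_mul]
    linarith
  have h5 := (neg_le_abs _).trans
    (abs_reApplyInnerSelf_le (A (ω (k + 1)) - A x₀ - (ω (k + 1) - x₀) • B) v)
  rw [reApplyInnerSelf_sub, reApplyInnerSelf_sub, reApplyInnerSelf_real_smul, ← hδ] at h5
  have h6 : ‖A (ω (k + 1)) - A x₀ - δ • B‖ * ‖v‖ ^ 2 ≤ |δ| * (m / 4) := by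
    have h7 : ‖A (ω (k + 1)) - A x₀ - δ • B‖ ≤ c * |δ| := hsc _ hk2 _ (mem_of_mem_nhds hs0)
    have h8 : c * (‖e‖ ^ 2 + 1) = m / 4 := by rw [hc']; field_simp
    calc _ ≤ c * |δ| * (‖e‖ ^ 2 + 1) := by
          gcongr
          have : ‖v‖ ^ 2 ≤ ‖e‖ ^ 2 := by gcongr
          linarith
      _ = |δ| * (m / 4) := by rw [← h8]; ring
  have h9 : |δ| * (m - m / 4) ≤ δ * B.reApplyInnerSelf v := by
    have h10 : |B.reApplyInnerSelf v - B.reApplyInnerSelf e| ≤ m / 4 := by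
      refine (abs_reApplyInnerSelf_sub_le B v e).trans (le_trans ?_ hk3.le)
      calc ‖B‖ * ‖v - e‖ * (‖v‖ + ‖e‖)
          ≤ ‖B‖ * (2 / ε * (‖A x₀ - A (ω k)‖ * ‖e‖)) * (‖e‖ + ‖e‖) := by gcongr
        _ = _ := by ring
    have h11 : |δ| * m = δ * B.reApplyInnerSelf e := by rw [hm, ← abs_mul, abs_of_pos hpos]
    have h12 : |δ * (B.reApplyInnerSelf v - B.reApplyInnerSelf e)| ≤ |δ| * (m / 4) := by
      rw [abs_mul]; gcongr
    linarith [(abs_le.1 h12).1]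
  have h13 : |δ| * (m / 2) ≤ M * ‖v - e‖ ^ 2 := by linarith
  have h14 : ‖v - e‖ ≤ 2 / ε * (L * ‖e‖) * |ω k - x₀| := by
    refine hr.trans ?_
    rw [norm_sub_rev] at hk1
    calc _ ≤ 2 / ε * (L * ‖ω k - x₀‖ * ‖e‖) := by gcongr
      _ = _ := by rw [Real.norm_eq_abs]; ring
  have hM0 : 0 ≤ M := by positivity
  calc |δ| = 2 / m * (|δ| * (m / 2)) := by field_simp
    _ ≤ 2 / m * (M * (2 / ε * (L * ‖e‖) * |ω k - x₀|) ^ 2) := by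
        refine mul_le_mul_of_nonneg_left (h13.trans ?_) (by positivity)
        gcongr
    _ = _ := by rw [mul_pow _ |ω k - x₀|, sq_abs]; ring

/-- Quadratic convergence of the subspace procedure to a unique global minimizer at which zero is
no boundary point of the generalized derivative of the largest eigenvalue. -/
theorem IsSubspaceProcedure.isBigO {a b : ℝ} (h : IsSubspaceProcedure A (Icc a b) ε ω V)
    (hs : ∀ x, (A x : E →ₗ[ℂ] E).IsSymmetric) (hc : ∀ x, IsCompactOperator (A x)) (hε : 0 < ε)
    (hcont : ContinuousOn A (Icc a b)) {x₀ : ℝ} (hx₀ : x₀ ∈ Icc a b)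
    (huniq : ∀ x ∈ Icc a b, x ≠ x₀ → lambdaMax (A x₀) < lambdaMax (A x))
    {B : E →L[ℂ] E} (hA : HasStrictDerivAt A B x₀)
    [FiniteDimensional ℂ (Module.End.eigenspace (A x₀ : E →ₗ[ℂ] E) (lambdaMax (A x₀) : ℂ))]
    (h0 : (0 : ℝ) ∉ frontier (clarkeDeriv (fun x => lambdaMax (A x)) x₀)) :
    (fun k : ℕ => |ω (k + 1) - x₀|) =O[atTop] (fun k : ℕ => (ω k - x₀) ^ 2) := by
  have hω : Tendsto ω atTop (𝓝 x₀) := h.tendsto hs hc hε isCompact_Icc hcont hx₀ huniq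
  -- Finite dimensionality passes from a late iterate to the limit at the price of shrinking `ε`; it
  -- isolates the top eigenvalue at `x₀`.
  have hnear : FiniteDimensional ℂ (nearTopEigenspace (A x₀) (ε / 2)) := by
    have hlim : Tendsto (fun k => 2 * ‖A x₀ - A (ω k)‖) atTop
        (𝓝 (2 * ‖A x₀ - A x₀‖)) :=
      ((tendsto_const_nhds.sub (hA.hasDerivAt.continuousAt.tendsto.comp hω)).norm).const_mul 2
    obtain ⟨k, hk⟩ := (hlim.eventually_lt_const
      (show _ < ε - ε / 2 by rw [sub_self, norm_zero]; linarith)).exists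
    have := h.finiteDimensional_nearTopEigenspace k
    exact SubspaceFramework.finiteDimensional_nearTopEigenspace (hs _) (hc _) (hs (ω k)) (hc _) hk
  obtain ⟨g, hg, hgap⟩ := exists_gap (hs x₀) (hc x₀) (half_pos hε)
  have hmin (y : ℝ) (hy : y ∈ Icc a b) :
      lambdaMax (A x₀) ≤ lambdaMax (A y) := by
    rcases eq_or_ne y x₀ with rfl | hne
    · exact le_rfl
    · exact (huniq y hy hne).le
  have hright : ∃ C, ∀ᶠ k in atTop, x₀ < ω (k + 1) →
      |ω (k + 1) - x₀| ≤ C * (ω k - x₀) ^ 2 := by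
    -- At the endpoint no iterate lies to the right, so no slope is needed.
    rcases hx₀.2.eq_or_lt with hb | hb
    · exact ⟨0, Eventually.of_forall fun k hk => absurd ((h.mem _).2.trans hb.ge) (not_le.2 hk)⟩
    obtain ⟨e, he, hpos⟩ := exists_pos_reApplyInnerSelf hs hc hA hg hgap
      (mem_of_superset (Ioo_mem_nhdsGT hb) fun y hy =>
        hmin y ⟨hx₀.1.trans hy.1.le, hy.2.le⟩) h0
    obtain ⟨C, hC⟩ := h.exists_abs_sub_le hs hc hε hx₀ hA hω he
    exact ⟨C, hC.mono fun k hk hlt => hk (mul_pos (sub_pos.2 hlt) hpos)⟩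
  have hleft : ∃ C, ∀ᶠ k in atTop, ω (k + 1) < x₀ →
      |ω (k + 1) - x₀| ≤ C * (ω k - x₀) ^ 2 := by
    rcases hx₀.1.eq_or_lt with ha | ha
    · exact ⟨0, Eventually.of_forall fun k hk => absurd (ha.ge.trans (h.mem _).1) (not_le.2 hk)⟩
    obtain ⟨e, he, hneg⟩ := exists_neg_reApplyInnerSelf hs hc hA hg hgap
      (mem_of_superset (Ioo_mem_nhdsLT ha) fun y hy =>
        hmin y ⟨hy.1.le, hy.2.le.trans hx₀.2⟩) h0
    obtain ⟨C, hC⟩ := h.exists_abs_sub_le hs hc hε hx₀ hA hω he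
    exact ⟨C, hC.mono fun k hk hlt => hk (mul_pos_of_neg_of_neg (sub_neg.2 hlt) hneg)⟩
  obtain ⟨C₁, hC₁⟩ := hright
  obtain ⟨C₂, hC₂⟩ := hleft
  refine IsBigO.of_bound (max 0 (max C₁ C₂)) ?_
  filter_upwards [hC₁, hC₂] with k h1 h2
  rw [Real.norm_eq_abs, abs_abs, Real.norm_eq_abs, abs_of_nonneg (sq_nonneg (ω k - x₀))]
  rcases lt_trichotomy (ω (k + 1)) x₀ with hlt | heq | hlt
  · exact (h2 hlt).trans (mul_le_mul_of_nonneg_right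
      ((le_max_right _ _).trans (le_max_right _ _)) (sq_nonneg _))
  · rw [heq, sub_self, abs_zero]
    positivity
  · exact (h1 hlt).trans (mul_le_mul_of_nonneg_right
      ((le_max_left _ _).trans (le_max_right _ _)) (sq_nonneg _))

end Rate
end SubspaceFramework

theorem mainTheorem2 {H : Type*} [NormedAddCommGroup H] [InnerProductSpace ℂ H] [CompleteSpace H]
    {κ : ℕ} (A : Fin κ → H →L[ℂ] H)
    (hA_sa : ∀ i, IsSelfAdjoint (A i)) (hA_cpt : ∀ i, IsCompactOperator (A i))
    (U : Set ℝ) (hU_open : IsOpen U) (hU_int : U.OrdConnected)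
    (a b : ℝ) (hΩU : Icc a b ⊆ U)
    (f : Fin κ → ℝ → ℝ) (hf : ∀ i, AnalyticOnNhd ℝ (f i) U)
    -- the unique global minimizer
    (ωstar : ℝ) (hωstar_mem : ωstar ∈ Icc a b)
    (hωstar_min : ∀ x ∈ Icc a b, x ≠ ωstar →
      SubspaceFramework.lambdaMax (SubspaceFramework.operatorFamily f A ωstar) <
        SubspaceFramework.lambdaMax (SubspaceFramework.operatorFamily f A x))
    -- the largest eigenvalue at the minimizer has multiplicity `K ≥ 2`
    (K : ℕ) (hK : 2 ≤ K)
    (hmult : Module.finrank ℂ (Module.End.eigenspace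
      (SubspaceFramework.operatorFamily f A ωstar : H →ₗ[ℂ] H)
      ((SubspaceFramework.lambdaMax (SubspaceFramework.operatorFamily f A ωstar) : ℝ) : ℂ)) = K)
    -- zero is not a boundary point of the generalized derivatives of the coalescing eigenvalues
    (hder : ∀ j, 1 ≤ j → j ≤ K →
      (0 : ℝ) ∉ frontier (SubspaceFramework.clarkeDeriv
        (fun x : ℝ => SubspaceFramework.nthEigenvalue
          (SubspaceFramework.operatorFamily f A x) j) ωstar))
    (ε : ℝ) (hε : 0 < ε)
    (ω : ℕ → ℝ) (V : ℕ → Submodule ℂ H)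
    (hrun : SubspaceFramework.IsSubspaceProcedure
      (SubspaceFramework.operatorFamily f A) (Icc a b) ε ω V) :
    (fun k : ℕ => |ω (k + 1) - ωstar|) =O[atTop] (fun k : ℕ => (ω k - ωstar) ^ 2) := by
  have hpos : 0 < K := by lia
  have hfin := FiniteDimensional.of_finrank_pos (hmult ▸ hpos)
  have hnon := Module.nontrivial_of_finrank_pos (hmult ▸ hpos)
  have hH : Nontrivial H := (Submodule.subtype_injective _).nontrivial (α := Module.End.eigenspace
    (SubspaceFramework.operatorFamily f A ωstar : H →ₗ[ℂ] H)
    ((SubspaceFramework.lambdaMax (SubspaceFramework.operatorFamily f A ωstar) : ℝ) : ℂ))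
  have hd (x : ℝ) (hx : x ∈ Icc a b) :=
    SubspaceFramework.hasStrictDerivAt_operatorFamily (A := A) (fun i => hf i x (hΩU hx))
  have h0 := hder 1 le_rfl hpos
  simp only [SubspaceFramework.nthEigenvalue_one] at h0
  exact hrun.isBigO
    (SubspaceFramework.operatorFamily_isSymmetric fun i => (hA_sa i).isSymmetric)
    (SubspaceFramework.operatorFamily_isCompactOperator hA_cpt) hε
    (fun x hx => (hd x hx).hasDerivAt.continuousAt.continuousWithinAt) hωstar_mem hωstar_min
    (hd ωstar hωstar_mem) h0
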